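/- A cylindric partition with profile $c=(3,0)$ is a pair $\Lambda=(\lambda,\mu)$ of ordinary partitions (weakly decreasing sequences $\lambda=(\lambda_1,\lambda_2,\dots)$, $\mu=(\mu_1,\mu_2,\dots)$ of non-negative integers with finitely many non-zero entries) such that $\lambda_j\ge\mu_j$ and $\mu_j\ge\lambda_{j+3}$ for all $j\ge 1$; its size $|\Lambda|$ is the sum of all the $\lambda_j$ and all the $\mu_j$. More generally, a cylindric partition with profile $c=(c_1,\dots,c_r)$ is an $r$-tuple $(\lambda^{(1)},\dots,\lambda^{(r)})$ of ordinary partitions with $\lambda^{(i)}_j\ge\lambda^{(i+1)}_{j+c_{i+1}}$ for $1\le i<r$ and $\lambda^{(r)}_j\ge\lambda^{(1)}_{j+c_1}$, for all $j\ge1$. For complex $a,q$ with $|q|<1$ write $(a;q)_n=\prod_{k=1}^{n}(1-aq^{k-1})$ and $(a;q)_\infty=\lim_{n\to\infty}(a;q)_n$. **Theorem.** The cylindric partitions with profile $c=(3,0)$ have the following generating function: for every $q\in\mathbb{C}$ with $|q|<1$, $$\sum_{\Lambda} q^{|\Lambda|}=\left(\sum_{n\ge 0}\frac{q^{n^2+2n}}{(q^4;q^4)_n}\right)\cdot\frac{(-q^2;q^2)_\infty}{(q;q)_\infty},$$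 where $\Lambda$ runs over all cylindric partitions with profile $(3,0)$, and both series converge absolutely. -/

import Mathlib

open Filter Topology

/-- A cylindric partition of rank `r` with profile `c = (c₁, …, c_r)`: a vector
`(λ⁽¹⁾, …, λ⁽ʳ⁾)` of ordinary partitions with
`λ⁽ⁱ⁾_j ≥ λ⁽ⁱ⁺¹⁾_{j + c_{i+1}}` for `1 ≤ i < r` and `λ⁽ʳ⁾_j ≥ λ⁽¹⁾_{j + c₁}`, for all `j ≥ 1`.

An ordinary partition is given by its weakly decreasing, finitely supported sequence of parts,
extended by zeros. Rows and positions are counted from `0`, that is, `row i j` is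
`λ⁽ⁱ⁺¹⁾_{j+1}` and `c i` is `c_{i+1}`. The addition `i + 1` in `Fin r` is cyclic, so that the
field `row_le` contains both families of inequalities. -/
structure CylindricPartition {r : ℕ} [NeZero r] (c : Fin r → ℕ) where
  /-- The rows `λ⁽¹⁾, …, λ⁽ʳ⁾`. -/
  row : Fin r → ℕ →₀ ℕ
  /-- Each row is weakly decreasing. -/
  row_antitone : ∀ i, Antitone (row i)
  /-- The inequalities between cyclically consecutive rows. -/
  row_le : ∀ i j, row (i + 1) (j + c (i + 1)) ≤ row i j

/-- The size `|Λ|`: the sum of all the parts of all the rows. -/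
def CylindricPartition.size {r : ℕ} [NeZero r] {c : Fin r → ℕ}
    (Λ : CylindricPartition c) : ℕ :=
  ∑ i, (Λ.row i).sum fun _ part => part

/-- The finite `q`-Pochhammer symbol `(a; q)_n = ∏_{k=1}^n (1 - a q^{k-1})`. -/
noncomputable def qPochhammer (a q : ℂ) (n : ℕ) : ℂ :=
  ∏ k ∈ Finset.range n, (1 - a * q ^ k)

/-- The infinite `q`-Pochhammer symbol `(a; q)_∞ = lim_{n → ∞} (a; q)_n`, for `|q| < 1`. -/
noncomputable def qPochhammerInf (a q : ℂ) : ℂ :=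
  limUnder atTop (qPochhammer a q)

theorem summable_norm_qPochhammer (a : ℂ) {q : ℂ} (hq : ‖q‖ < 1) :
    Summable fun k : ℕ => ‖-(a * q ^ k)‖ := by
  simp only [norm_neg, norm_mul, norm_pow]
  exact (summable_geometric_of_lt_one (norm_nonneg q) hq).mul_left _

theorem tendsto_qPochhammer_tprod (a : ℂ) {q : ℂ} (hq : ‖q‖ < 1) :
    Tendsto (qPochhammer a q) atTop (𝓝 (∏' k : ℕ, (1 - a * q ^ k))) := by
  have h := (multipliable_one_add_of_summable
    (summable_norm_qPochhammer a hq)).hasProd.tendsto_prod_nat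
  simp only [← sub_eq_add_neg] at h
  exact h

/-- The limit in the definition of `(a; q)_∞` exists for `|q| < 1`. -/
theorem tendsto_qPochhammer (a : ℂ) {q : ℂ} (hq : ‖q‖ < 1) :
    Tendsto (qPochhammer a q) atTop (𝓝 (qPochhammerInf a q)) :=
  tendsto_nhds_limUnder ⟨_, tendsto_qPochhammer_tprod a hq⟩

/-- `(q; q)_∞` does not vanish for `|q| < 1`. -/
theorem qPochhammerInf_self_ne_zero {q : ℂ} (hq : ‖q‖ < 1) : qPochhammerInf q q ≠ 0 := by
  have h : qPochhammerInf q q = ∏' k : ℕ, (1 - q * q ^ k) :=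
    tendsto_nhds_unique (tendsto_qPochhammer q hq) (tendsto_qPochhammer_tprod q hq)
  rw [h]
  have h2 := tprod_one_add_ne_zero_of_summable (f := fun k : ℕ => -(q * q ^ k)) ?_
    (summable_norm_qPochhammer q hq)
  · simpa only [← sub_eq_add_neg] using h2
  · intro k hk
    have h1 : q ^ (k + 1) = 1 := by linear_combination -hk
    have h3 : ‖q‖ ^ (k + 1) < 1 := pow_lt_one₀ (norm_nonneg q) hq (Nat.succ_ne_zero k)
    rw [← norm_pow, h1, norm_one] at h3
    exact lt_irrefl _ h3

/-! Merge the two rows into the single sequence λ₀, λ₁, μ₀, λ₂, μ₁, λ₃, μ₂, … (positions from 0).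
The cylindric conditions then say that the first entry is the largest and that no entry is exceeded
by one standing two or more places later. So an ascent can only occur between neighbours, and two
ascents never overlap. Exchanging the two entries of every ascent produces an ordinary partition
with a strict drop at each exchanged pair.

Record this partition by its successive drops and subtract 1 at the exchanged pairs: what remains is
an arbitrary multiplicity function. Cylindric partitions thus correspond to pairs of a partition and
a sparse set `T`, where `t ∈ T` contributes `t + 2` to the size (`nearlyAntitoneEquiv`,
`degree_nearlyAntitoneSeq`). The partition accounts for the factor 1/(q;q)_∞
(`tsum_pow_multWeight`).

The sum over `T` is a Rogers–Ramanujan sum: parts at least 2, differences at least 2. Its evaluation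
`tsum_pow_sparseWeight` embeds both sides in sequences that tend to 1 and satisfy g k = g (k+1) +
q^(k+2) g (k+2); `eq_zero_of_recurrence` makes them equal. -/

/-! ### Weights and absolute convergence. -/

/-- The weight `∑ i, (i + k) * f i` of a multiplicity function. -/
noncomputable def multWeight (k : ℕ) : (ℕ →₀ ℕ) →ₗ[ℕ] ℕ :=
  Finsupp.linearCombination ℕ fun i => i + k

/-- Finite sets of natural numbers without two consecutive elements. -/
abbrev SparseFinset : Type := {T : Finset ℕ // ∀ t ∈ T, t + 1 ∉ T}

/-- The weight `∑ t ∈ T, (t + k)` of a sparse set. -/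
def sparseWeight (k : ℕ) (T : SparseFinset) : ℕ := ∑ t ∈ T.1, (t + k)

theorem multWeight_apply (k : ℕ) (f : ℕ →₀ ℕ) :
    multWeight k f = ∑ i ∈ f.support, (i + k) * f i := by
  simp [multWeight, Finsupp.linearCombination_apply, Finsupp.sum, mul_comm]

theorem multWeight_mono {k l : ℕ} (h : k ≤ l) (f : ℕ →₀ ℕ) :
    multWeight k f ≤ multWeight l f := by
  rw [multWeight_apply, multWeight_apply]
  gcongr

theorem le_multWeight (k : ℕ) {f : ℕ →₀ ℕ} (hf : f ≠ 0) : k ≤ multWeight k f := by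
  obtain ⟨i, hi⟩ := Finsupp.support_nonempty_iff.2 hf
  rw [multWeight_apply]
  refine le_trans ?_ (Finset.single_le_sum (f := fun i => (i + k) * f i)
    (fun _ _ => Nat.zero_le _) hi)
  have : 1 ≤ f i := Nat.one_le_iff_ne_zero.2 (Finsupp.mem_support_iff.1 hi)
  nlinarith

/-- Passing to graphs embeds the multiplicity functions into the finite subsets of ℕ × ℕ and turns
the power into a product over the graph. Finite products of a summable family are summable. -/
theorem summable_pow_multWeight_one {r : ℝ} (h0 : 0 ≤ r) (h1 : r < 1) :
    Summable fun f : ℕ →₀ ℕ => r ^ multWeight 1 f := by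
  -- Graphs contain only nonzero values, so `F` may vanish at `p.2 = 0`; the power would be 1 there
  -- and destroy summability.
  let F : ℕ × ℕ → ℝ := fun p => if p.2 = 0 then 0 else r ^ ((p.1 + 1) * p.2)
  have hF0 : ∀ p, 0 ≤ F p := fun p => by
    dsimp only [F]
    split_ifs
    · exact le_rfl
    · positivity
  have hgeo := summable_geometric_of_lt_one h0 h1
  have hgeo' : Summable fun n : ℕ => r ^ (n - 1) := by
    rw [← summable_nat_add_iff 1]
    simpa using hgeo
  have hF : Summable F := by
    refine Summable.of_nonneg_of_le hF0 (fun p => ?_)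
      (hgeo.mul_of_nonneg hgeo' (fun n => pow_nonneg h0 n) fun n => pow_nonneg h0 _)
    dsimp only [F]
    split_ifs with h
    · positivity
    · rw [← pow_add]
      refine pow_le_pow_of_le_one h0 h1.le ?_
      obtain ⟨n, hn⟩ := Nat.exists_eq_succ_of_ne_zero h
      rw [hn]
      simp only [Nat.succ_eq_add_one, Nat.add_sub_cancel]
      nlinarith
  have hprod : Summable fun s : Finset (ℕ × ℕ) => ∏ p ∈ s, F p := by
    refine summable_finsetProd_of_summable_norm ?_
    simpa only [Real.norm_of_nonneg (hF0 _)] using hF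
  refine (hprod.comp_injective (Finsupp.graph_injective ℕ ℕ)).congr fun f => ?_
  rw [Function.comp_apply, multWeight_apply, ← Finset.prod_pow_eq_pow_sum, Finsupp.graph,
    Finset.prod_map]
  refine Finset.prod_congr rfl fun i hi => ?_
  exact if_neg (Finsupp.mem_support_iff.1 hi)

/-- The multiplicity function `∑ t ∈ T, δ_{t + 1}`. -/
noncomputable def sparseMult (T : SparseFinset) : ℕ →₀ ℕ :=
  Finsupp.indicator (T.1.map ⟨Nat.succ, Nat.succ_injective⟩) fun _ _ => 1

theorem sparseMult_succ (T : SparseFinset) (i : ℕ) :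
    sparseMult T (i + 1) = if i ∈ T.1 then 1 else 0 := by
  simp [sparseMult, Finsupp.indicator_apply]

theorem sparseMult_zero (T : SparseFinset) : sparseMult T 0 = 0 := by
  simp [sparseMult, Finsupp.indicator_apply]

theorem sparseMult_injective : Function.Injective sparseMult := by
  intro T U h
  ext i
  have := DFunLike.congr_fun h (i + 1)
  rw [sparseMult_succ, sparseMult_succ] at this
  split_ifs at this <;> simp_all

/-- Lets sparse sets inherit summability from multiplicity functions, and later gives the cost `t +
2` of an ascent. -/
theorem multWeight_sparseMult (k : ℕ) (T : SparseFinset) :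
    multWeight k (sparseMult T) = sparseWeight (k + 1) T := by
  have hs : (sparseMult T).support = T.1.map ⟨Nat.succ, Nat.succ_injective⟩ := by
    ext i
    cases i <;> simp [sparseMult_succ, sparseMult_zero]
  rw [multWeight_apply, hs, Finset.sum_map, sparseWeight]
  refine Finset.sum_congr rfl fun t ht => ?_
  simp [sparseMult_succ, ht]
  ring

theorem summable_norm_pow_multWeight {q : ℂ} (hq : ‖q‖ < 1) (k : ℕ) :
    Summable fun f : ℕ →₀ ℕ => ‖q ^ multWeight (k + 1) f‖ := by
  refine Summable.of_nonneg_of_le (fun _ => norm_nonneg _) (fun f => ?_)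
    (summable_pow_multWeight_one (norm_nonneg q) hq)
  rw [norm_pow]
  exact pow_le_pow_of_le_one (norm_nonneg q) hq.le (multWeight_mono (by omega) f)

theorem summable_norm_pow_sparseWeight {q : ℂ} (hq : ‖q‖ < 1) (k : ℕ) :
    Summable fun T : SparseFinset => ‖q ^ sparseWeight (k + 2) T‖ := by
  simpa only [Function.comp_def, multWeight_sparseMult] using
    (summable_norm_pow_multWeight hq k).comp_injective sparseMult_injective

/-- Dominated convergence: every weight except that of `a₀` grows without bound. It supplies the
limit 1 for partitions and for sparse sets. -/
theorem tendsto_tsum_pow_of_le_weight {α : Type*} {q : ℂ} (hq : ‖q‖ < 1) (a₀ : α)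
    (w : ℕ → α → ℕ) (hw₀ : ∀ k, w k a₀ = 0) (hmono : ∀ k a, w 0 a ≤ w k a)
    (hw : ∀ k a, a ≠ a₀ → k ≤ w k a) (hsum : Summable fun a => ‖q ^ w 0 a‖) :
    Tendsto (fun k => ∑' a, q ^ w k a) atTop (𝓝 1) := by
  classical
  have h := tendsto_tsum_of_dominated_convergence (𝓕 := atTop) (f := fun k a => q ^ w k a)
    (g := fun a => if a = a₀ then (1 : ℂ) else 0) hsum (fun a => ?_)
    (Eventually.of_forall fun k a => ?_)
  · simpa using h
  · by_cases ha : a = a₀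
    · simp [ha, hw₀]
    · simp only [ha, if_false]
      refine (tendsto_pow_atTop_nhds_zero_of_norm_lt_one hq).comp ?_
      exact tendsto_atTop_mono (fun k => hw k a ha) tendsto_id
  · rw [norm_pow, norm_pow]
    exact pow_le_pow_of_le_one (norm_nonneg q) hq.le (hmono k a)

/-! ### Functional equations from removing the smallest part. -/

/-- Splitting a multiplicity function according to whether it vanishes at `0`. -/
noncomputable def multSplit : (ℕ →₀ ℕ) ⊕ (ℕ →₀ ℕ) → (ℕ →₀ ℕ) :=
  Sum.elim (Finsupp.mapDomain Nat.succ) fun f => f + Finsupp.single 0 1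

theorem multSplit_bijective : Function.Bijective multSplit := by
  have hz : ∀ f : ℕ →₀ ℕ, Finsupp.mapDomain Nat.succ f 0 = 0 := fun f =>
    Finsupp.mapDomain_of_notMem_range _ _ (by simp)
  have hs : ∀ (f : ℕ →₀ ℕ) i, Finsupp.mapDomain Nat.succ f (i + 1) = f i := fun f i =>
    Finsupp.mapDomain_apply Nat.succ_injective _ _
  constructor
  · rintro (f | f) (g | g) h
    · exact congrArg _ (Finsupp.mapDomain_injective Nat.succ_injective h)
    · have := DFunLike.congr_fun h 0
      simp [multSplit, hz] at this
    · have := DFunLike.congr_fun h 0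
      simp [multSplit, hz] at this
    · exact congrArg _ (add_right_cancel (h : f + _ = g + _))
  · intro g
    by_cases h : g 0 = 0
    · refine ⟨.inl (g.comapDomain Nat.succ Nat.succ_injective.injOn), ?_⟩
      ext i
      cases i with
      | zero => simp [multSplit, hz, h]
      | succ i => simp only [multSplit, Sum.elim_inl, hs]; rfl
    · refine ⟨.inr (g - Finsupp.single 0 1), ?_⟩
      refine tsub_add_cancel_of_le (Finsupp.single_le_iff.2 ?_)
      omega

theorem multWeight_mapDomain_succ (k : ℕ) (f : ℕ →₀ ℕ) :
    multWeight k (Finsupp.mapDomain Nat.succ f) = multWeight (k + 1) f := by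
  rw [multWeight, Finsupp.linearCombination_mapDomain, multWeight]
  congr 2
  funext i
  simp [add_assoc, add_comm 1 k]

theorem tsum_pow_multWeight_succ {q : ℂ} (hq : ‖q‖ < 1) (k : ℕ) :
    (1 - q ^ (k + 1)) * ∑' f, q ^ multWeight (k + 1) f = ∑' f, q ^ multWeight (k + 2) f := by
  have h1 := (summable_norm_pow_multWeight hq k).of_norm
  have h2 := (summable_norm_pow_multWeight hq (k + 1)).of_norm
  have h := (Equiv.ofBijective _ multSplit_bijective).tsum_eq fun f => q ^ multWeight (k + 1) f
  have e1 : ∀ f, multWeight (k + 1) (multSplit (.inl f)) = multWeight (k + 1 + 1) f := fun f =>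
    multWeight_mapDomain_succ _ _
  have e2 : ∀ f, q ^ multWeight (k + 1) (multSplit (.inr f)) =
      q ^ (k + 1) * q ^ multWeight (k + 1) f := fun f => by
    simp only [multSplit, Sum.elim_inr, map_add, pow_add]
    simp [multWeight, pow_add]
    ring
  rw [Summable.tsum_sum] at h
  · simp only [Equiv.ofBijective_apply, e1, e2, tsum_mul_left] at h
    linear_combination -h
  · simpa only [Function.comp_def, Equiv.ofBijective_apply, e1] using h2
  · simpa only [Function.comp_def, Equiv.ofBijective_apply, e2] using h1.mul_left _

theorem tsum_pow_multWeight {q : ℂ} (hq : ‖q‖ < 1) :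
    ∑' f, q ^ multWeight 1 f = (qPochhammerInf q q)⁻¹ := by
  have hstep : ∀ n, qPochhammer q q n * ∑' f, q ^ multWeight 1 f =
      ∑' f, q ^ multWeight (n + 1) f := by
    intro n
    induction n with
    | zero => simp [qPochhammer]
    | succ n ih =>
      rw [← tsum_pow_multWeight_succ hq n, ← ih, qPochhammer, qPochhammer,
        Finset.prod_range_succ]
      ring
  have h1 := (tendsto_qPochhammer q hq).mul_const (∑' f, q ^ multWeight 1 f)
  simp only [hstep] at h1
  have h2 := tendsto_tsum_pow_of_le_weight hq (0 : ℕ →₀ ℕ) (fun k => multWeight (k + 1))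
    (fun k => map_zero _) (fun k f => multWeight_mono (by omega) f)
    (fun k f hf => (Nat.le_succ k).trans (le_multWeight (k + 1) hf))
    (summable_norm_pow_multWeight hq 0)
  exact eq_inv_of_mul_eq_one_right (tendsto_nhds_unique h1 h2)

/-- Splitting a sparse set according to whether it contains `0`. -/
def sparseSplit : SparseFinset ⊕ SparseFinset → SparseFinset :=
  Sum.elim (fun T => ⟨T.1.map (addRightEmbedding 1), by
      have := T.2
      simp only [Finset.mem_map, addRightEmbedding_apply]
      grind⟩)
    fun T => ⟨insert 0 (T.1.map (addRightEmbedding 2)), by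
      have := T.2
      simp only [Finset.mem_map, Finset.mem_insert, addRightEmbedding_apply]
      grind⟩

theorem sparseSplit_bijective : Function.Bijective sparseSplit := by
  have m1 : ∀ T i, i ∈ (sparseSplit (.inl T)).1 ↔ ∃ t ∈ T.1, t + 1 = i := fun T i => by
    simp [sparseSplit]
  have m2 : ∀ T i, i ∈ (sparseSplit (.inr T)).1 ↔ i = 0 ∨ ∃ t ∈ T.1, t + 2 = i := fun T i => by
    simp [sparseSplit]
  constructor
  · rintro (T | T) (U | U) h <;>
      have h' := fun i => congrArg (fun V : SparseFinset => i ∈ V.1) h <;>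
      simp only [m1, m2, eq_iff_iff] at h'
    · congr 1
      ext i
      have := h' (i + 1)
      grind
    · have := h' 0
      grind
    · have := h' 0
      grind
    · congr 1
      ext i
      have := h' (i + 2)
      grind
  · intro U
    have hU := U.2
    by_cases h : 0 ∈ U.1
    · refine ⟨.inr ⟨U.1.preimage (· + 2) (add_left_injective 2).injOn, ?_⟩, ?_⟩
      · simp only [Finset.mem_preimage]
        grind
      · ext i
        simp only [m2, Finset.mem_preimage]
        constructor
        · grind
        · intro hi
          match i with
          | 0 => simp
          | 1 => exact absurd hi (hU 0 h)
          | i + 2 => exact .inr ⟨i, hi, rfl⟩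
    · refine ⟨.inl ⟨U.1.preimage (· + 1) (add_left_injective 1).injOn, ?_⟩, ?_⟩
      · simp only [Finset.mem_preimage]
        grind
      · ext i
        simp only [m1, Finset.mem_preimage]
        constructor
        · grind
        · intro hi
          match i with
          | 0 => exact absurd hi h
          | i + 1 => exact ⟨i, hi, rfl⟩

/-- The smallest admissible part `k + 2` is either absent, or present and then excludes `k + 3`. -/
theorem tsum_pow_sparseWeight_succ {q : ℂ} (hq : ‖q‖ < 1) (k : ℕ) :
    ∑' T, q ^ sparseWeight (k + 2) T =
      ∑' T, q ^ sparseWeight (k + 3) T + q ^ (k + 2) * ∑' T, q ^ sparseWeight (k + 4) T := by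
  have h1 := (summable_norm_pow_sparseWeight hq (k + 1)).of_norm
  have h2 := (summable_norm_pow_sparseWeight hq (k + 2)).of_norm
  rw [← (Equiv.ofBijective _ sparseSplit_bijective).tsum_eq fun T => q ^ sparseWeight (k + 2) T]
  have e1 : ∀ T, sparseWeight (k + 2) (sparseSplit (.inl T)) = sparseWeight (k + 1 + 2) T := by
    intro T
    simp only [sparseSplit, Sum.elim_inl, sparseWeight, Finset.sum_map, addRightEmbedding_apply]
    exact Finset.sum_congr rfl fun _ _ => by ring
  have e2 : ∀ T, q ^ sparseWeight (k + 2) (sparseSplit (.inr T)) =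
      q ^ (k + 2) * q ^ sparseWeight (k + 2 + 2) T := by
    intro T
    rw [← pow_add]
    congr 1
    simp only [sparseSplit, Sum.elim_inr, sparseWeight]
    rw [Finset.sum_insert (by simp), Finset.sum_map, zero_add]
    exact congrArg _ (Finset.sum_congr rfl fun _ _ => by simp; ring)
  rw [Summable.tsum_sum]
  · simp only [Equiv.ofBijective_apply, e1, e2, tsum_mul_left]
  · simpa only [Function.comp_def, Equiv.ofBijective_apply, e1] using h1
  · simpa only [Function.comp_def, Equiv.ofBijective_apply, e2] using h2.mul_left _

theorem tendsto_tsum_pow_sparseWeight {q : ℂ} (hq : ‖q‖ < 1) :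
    Tendsto (fun k => ∑' T, q ^ sparseWeight (k + 2) T) atTop (𝓝 1) := by
  refine tendsto_tsum_pow_of_le_weight hq (⟨∅, by simp⟩ : SparseFinset)
    (fun k => sparseWeight (k + 2)) (fun k => by simp [sparseWeight]) (fun k T => ?_)
    (fun k T hT => ?_) (summable_norm_pow_sparseWeight hq 0)
  · simp only [sparseWeight]
    gcongr
    omega
  · obtain ⟨t, ht⟩ := Finset.nonempty_iff_ne_empty.2 fun h => hT (Subtype.ext h)
    have := Finset.single_le_sum (f := fun t => t + (k + 2)) (fun _ _ => Nat.zero_le _) ht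
    simp only [sparseWeight]
    omega

/-! ### Uniqueness for the recurrence. -/

/-- The maximum of two consecutive norms grows by at most the factor 1 + r^k ≤ exp (r^k) when going
from k + 1 back to k. The product of these factors is bounded, so the limit 0 propagates back to
every index. -/
theorem eq_zero_of_recurrence {q : ℂ} (hq : ‖q‖ < 1) {d : ℕ → ℂ}
    (hd : ∀ k, d k = d (k + 1) + q ^ (k + 2) * d (k + 2)) (h0 : Tendsto d atTop (𝓝 0)) (k : ℕ) :
    d k = 0 := by
  set r := ‖q‖
  have hr0 : 0 ≤ r := norm_nonneg q
  have hgeo := summable_geometric_of_lt_one hr0 hq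
  let e : ℕ → ℝ := fun k => max ‖d k‖ ‖d (k + 1)‖
  have he : ∀ k, e k ≤ Real.exp (r ^ k) * e (k + 1) := by
    intro k
    have h1 : 1 + r ^ k ≤ Real.exp (r ^ k) := by linarith [Real.add_one_le_exp (r ^ k)]
    have h2 : ‖d k‖ ≤ ‖d (k + 1)‖ + r ^ k * ‖d (k + 2)‖ := by
      rw [hd k]
      refine (norm_add_le _ _).trans ?_
      rw [norm_mul, norm_pow]
      have : r ^ (k + 2) ≤ r ^ k := pow_le_pow_of_le_one hr0 hq.le (Nat.le_add_right k 2)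
      gcongr
    have h3 : ‖d (k + 1)‖ ≤ e (k + 1) := le_max_left _ _
    have h4 : ‖d (k + 2)‖ ≤ e (k + 1) := le_max_right _ _
    have h5 : 0 ≤ e (k + 1) := (norm_nonneg _).trans h3
    have h6 : 0 ≤ r ^ k := pow_nonneg hr0 k
    refine le_trans (max_le ?_ ?_) (mul_le_mul_of_nonneg_right h1 h5)
    · nlinarith
    · nlinarith
  have hlim : Tendsto e atTop (𝓝 0) := by
    have := h0.norm.max ((tendsto_add_atTop_iff_nat 1).2 h0).norm
    simpa using this
  have hbound : ∀ n, e k ≤ Real.exp (∑' i, r ^ i) * e (n + k) := by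
    have hstep : ∀ n, e k ≤ Real.exp (∑ i ∈ Finset.range n, r ^ (i + k)) * e (n + k) := by
      intro n
      induction n with
      | zero => simp
      | succ n ih =>
        refine ih.trans ?_
        rw [Finset.sum_range_succ, Real.exp_add, mul_assoc, add_right_comm]
        exact mul_le_mul_of_nonneg_left (he _) (Real.exp_pos _).le
    intro n
    refine (hstep n).trans (mul_le_mul_of_nonneg_right (Real.exp_le_exp.2 ?_)
      (le_max_of_le_left (norm_nonneg _)))
    refine le_trans (Finset.sum_le_sum fun i _ => ?_)
      (hgeo.sum_le_tsum (Finset.range n) fun i _ => pow_nonneg hr0 i)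
    exact pow_le_pow_of_le_one hr0 hq.le (Nat.le_add_right i k)
  have hfin : Tendsto (fun n => Real.exp (∑' i, r ^ i) * e (n + k)) atTop (𝓝 0) := by
    simpa using ((tendsto_add_atTop_iff_nat k).2 hlim).const_mul (Real.exp (∑' i, r ^ i))
  exact norm_le_zero_iff.1 ((le_max_left _ _).trans (ge_of_tendsto' hfin hbound))

/-! ### Infinite products. -/

theorem qPochhammer_succ' (a q : ℂ) (n : ℕ) :
    qPochhammer a q (n + 1) = (1 - a) * qPochhammer (a * q) q n := by
  rw [qPochhammer, Finset.prod_range_succ', qPochhammer, mul_comm]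
  simp only [pow_zero, mul_one, pow_succ']
  simp only [mul_assoc]

theorem qPochhammerInf_eq_mul (a : ℂ) {q : ℂ} (hq : ‖q‖ < 1) :
    qPochhammerInf a q = (1 - a) * qPochhammerInf (a * q) q := by
  have h1 := (tendsto_add_atTop_iff_nat 1).2 (tendsto_qPochhammer a hq)
  simp only [qPochhammer_succ'] at h1
  exact tendsto_nhds_unique h1 ((tendsto_qPochhammer (a * q) hq).const_mul _)

theorem qPochhammerInf_ne_zero {a q : ℂ} (hq : ‖q‖ < 1) (ha : ∀ k : ℕ, 1 - a * q ^ k ≠ 0) :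
    qPochhammerInf a q ≠ 0 := by
  rw [tendsto_nhds_unique (tendsto_qPochhammer a hq) (tendsto_qPochhammer_tprod a hq)]
  have h := tprod_one_add_ne_zero_of_summable (f := fun k : ℕ => -(a * q ^ k))
    (fun k => by rw [← sub_eq_add_neg]; exact ha k) (summable_norm_qPochhammer a hq)
  simpa only [← sub_eq_add_neg] using h

theorem one_sub_ne_zero_of_norm_lt_one {x : ℂ} (hx : ‖x‖ < 1) : 1 - x ≠ 0 := by
  intro h
  rw [← sub_eq_zero.1 h, norm_one] at hx
  exact lt_irrefl _ hx

theorem norm_pow_lt_one {q : ℂ} (hq : ‖q‖ < 1) {n : ℕ} (hn : n ≠ 0) : ‖q ^ n‖ < 1 := by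
  rw [norm_pow]
  exact pow_lt_one₀ (norm_nonneg q) hq hn

theorem one_sub_self_mul_pow_ne_zero {q : ℂ} (hq : ‖q‖ < 1) (k : ℕ) : 1 - q * q ^ k ≠ 0 := by
  rw [← pow_succ']
  exact one_sub_ne_zero_of_norm_lt_one (norm_pow_lt_one hq k.succ_ne_zero)

theorem one_add_pow_ne_zero {q : ℂ} (hq : ‖q‖ < 1) (k : ℕ) : 1 + q ^ k ≠ 0 := by
  cases k with
  | zero => norm_num
  | succ k =>
    rw [← sub_neg_eq_add]
    exact one_sub_ne_zero_of_norm_lt_one (by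
      rw [norm_neg]; exact norm_pow_lt_one hq k.succ_ne_zero)

theorem qPochhammer_self_ne_zero {q : ℂ} (hq : ‖q‖ < 1) (n : ℕ) : qPochhammer q q n ≠ 0 :=
  Finset.prod_ne_zero_iff.2 fun k _ => one_sub_self_mul_pow_ne_zero hq k

theorem exists_norm_inv_qPochhammer_self_le {q : ℂ} (hq : ‖q‖ < 1) :
    ∃ C, ∀ n, ‖(qPochhammer q q n)⁻¹‖ ≤ C := by
  obtain ⟨C, hC⟩ :=
    ((tendsto_qPochhammer q hq).inv₀ (qPochhammerInf_self_ne_zero hq)).norm.bddAbove_range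
  exact ⟨C, fun n => hC ⟨n, rfl⟩⟩

/-- `(-q ^ i; q)_∞`. -/
noncomputable def negPochhammerInf (q : ℂ) (i : ℕ) : ℂ := qPochhammerInf (-q ^ i) q

theorem negPochhammerInf_eq_mul {q : ℂ} (hq : ‖q‖ < 1) (i : ℕ) :
    negPochhammerInf q i = (1 + q ^ i) * negPochhammerInf q (i + 1) := by
  rw [negPochhammerInf, qPochhammerInf_eq_mul _ hq, negPochhammerInf, sub_neg_eq_add, neg_mul,
    ← pow_succ]

theorem qPochhammer_mul_negPochhammerInf {q : ℂ} (hq : ‖q‖ < 1) (i n : ℕ) :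
    qPochhammer (-q ^ i) q n * negPochhammerInf q (n + i) = negPochhammerInf q i := by
  induction n with
  | zero => simp [qPochhammer]
  | succ n ih =>
    rw [← ih, negPochhammerInf_eq_mul hq (n + i), qPochhammer, qPochhammer,
      Finset.prod_range_succ, add_right_comm]
    ring

/-- (-q^n;q)_∞ is the quotient of (-1;q)_∞ by (-1;q)_n, and (-1;q)_∞ is nonzero. -/
theorem tendsto_negPochhammerInf {q : ℂ} (hq : ‖q‖ < 1) :
    Tendsto (negPochhammerInf q) atTop (𝓝 1) := by
  have hne : ∀ k : ℕ, 1 - -q ^ 0 * q ^ k ≠ 0 := fun k => by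
    simpa using one_add_pow_ne_zero hq k
  have hlim : qPochhammerInf (-q ^ 0) q ≠ 0 := qPochhammerInf_ne_zero hq hne
  have h := (tendsto_qPochhammer (-q ^ 0) hq).inv₀ hlim |>.const_mul (negPochhammerInf q 0)
  rw [negPochhammerInf, mul_inv_cancel₀ hlim] at h
  refine h.congr fun n => ?_
  have hn : qPochhammer (-q ^ 0) q n ≠ 0 := Finset.prod_ne_zero_iff.2 fun k _ => hne k
  have := qPochhammer_mul_negPochhammerInf hq 0 n
  rw [add_zero] at this
  rw [← negPochhammerInf, ← this]
  generalize qPochhammer (-q ^ 0) q n = x at hn ⊢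
  field_simp

/-! ### The two-parameter series and Rogers' identity. -/

/-- The `n`-th term of `sparseSeries`. -/
noncomputable def sparseTerm (q : ℂ) (j i n : ℕ) : ℂ :=
  q ^ (n ^ 2 + 2 * j * n) * (qPochhammer (q ^ 2) (q ^ 2) n)⁻¹ * negPochhammerInf (q ^ 2) (n + i)

/-- The series `∑ n, q ^ (n ^ 2 + 2 * j * n) * (-q ^ (2 * n + 2 * i); q ^ 2)_∞ / (q ^ 2; q ^ 2)_n`. -/
noncomputable def sparseSeries (q : ℂ) (j i : ℕ) : ℂ := ∑' n, sparseTerm q j i n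

/-- Uniformity in `j` and `i` is what allows dominated convergence in `tendsto_sparseSeries`. -/
theorem exists_norm_sparseTerm_le {q : ℂ} (hq : ‖q‖ < 1) :
    ∃ C, ∀ j i n, ‖sparseTerm q j i n‖ ≤ ‖q‖ ^ n * C := by
  have hq2 : ‖q ^ 2‖ < 1 := norm_pow_lt_one hq two_ne_zero
  obtain ⟨C, hC⟩ := exists_norm_inv_qPochhammer_self_le hq2
  obtain ⟨D, hD⟩ := (tendsto_negPochhammerInf hq2).norm.bddAbove_range
  have hC0 : 0 ≤ C := (norm_nonneg _).trans (hC 0)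
  refine ⟨C * D, fun j i n => ?_⟩
  rw [sparseTerm, norm_mul, norm_mul, norm_pow, mul_assoc]
  have h1 : ‖q‖ ^ (n ^ 2 + 2 * j * n) ≤ ‖q‖ ^ n :=
    pow_le_pow_of_le_one (norm_nonneg q) hq.le
      ((Nat.le_self_pow two_ne_zero n).trans (Nat.le_add_right _ _))
  have h2 : ‖negPochhammerInf (q ^ 2) (n + i)‖ ≤ D := hD ⟨_, rfl⟩
  have h3 := hC n
  gcongr

theorem summable_sparseTerm {q : ℂ} (hq : ‖q‖ < 1) (j i : ℕ) : Summable (sparseTerm q j i) := by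
  obtain ⟨C, hC⟩ := exists_norm_sparseTerm_le hq
  exact .of_norm_bounded ((summable_geometric_of_lt_one (norm_nonneg q) hq).mul_right C) (hC j i)

/-- Split off the first factor 1 + q^(2n+2i) of the infinite product; its q^(2n) raises `j` by one.
-/
theorem sparseSeries_shift_product {q : ℂ} (hq : ‖q‖ < 1) (j i : ℕ) :
    sparseSeries q j i =
      sparseSeries q j (i + 1) + q ^ (2 * i) * sparseSeries q (j + 1) (i + 1) := by
  have hq2 : ‖q ^ 2‖ < 1 := norm_pow_lt_one hq two_ne_zero
  simp only [sparseSeries]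
  rw [← tsum_mul_left, ← (summable_sparseTerm hq j (i + 1)).tsum_add
    ((summable_sparseTerm hq (j + 1) (i + 1)).mul_left _)]
  refine tsum_congr fun n => ?_
  simp only [sparseTerm]
  rw [negPochhammerInf_eq_mul hq2 (n + i)]
  have : q ^ (n ^ 2 + 2 * (j + 1) * n) = q ^ (n ^ 2 + 2 * j * n) * q ^ (2 * n) := by ring
  rw [this, ← add_assoc]
  ring

/-- In the difference of the two series the factor 1 - q^(2n) kills the term n = 0 and otherwise
cancels the last factor of (q²;q²)_n; then shift n. -/
theorem sparseSeries_shift_exponent {q : ℂ} (hq : ‖q‖ < 1) (j i : ℕ) :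
    sparseSeries q j i =
      sparseSeries q (j + 1) i + q ^ (2 * j + 1) * sparseSeries q (j + 1) (i + 1) := by
  have hq2 : ‖q ^ 2‖ < 1 := norm_pow_lt_one hq two_ne_zero
  have hs := (summable_sparseTerm hq j i).sub (summable_sparseTerm hq (j + 1) i)
  simp only [sparseSeries]
  rw [← sub_eq_iff_eq_add', ← (summable_sparseTerm hq j i).tsum_sub
    (summable_sparseTerm hq (j + 1) i), hs.tsum_eq_zero_add, ← tsum_mul_left]
  have h0 : sparseTerm q j i 0 - sparseTerm q (j + 1) i 0 = 0 := by simp [sparseTerm]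
  rw [h0, zero_add]
  refine tsum_congr fun n => ?_
  simp only [sparseTerm]
  have hn := qPochhammer_self_ne_zero hq2 n
  have hn' := one_sub_self_mul_pow_ne_zero hq2 n
  have e : qPochhammer (q ^ 2) (q ^ 2) (n + 1) =
      qPochhammer (q ^ 2) (q ^ 2) n * (1 - q ^ 2 * (q ^ 2) ^ n) := Finset.prod_range_succ _ _
  have e1 : q ^ ((n + 1) ^ 2 + 2 * (j + 1) * (n + 1)) =
      q ^ (2 * j + 1) * q ^ (n ^ 2 + 2 * (j + 1) * n) * (q ^ 2 * (q ^ 2) ^ n) := by ring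
  have e2 : q ^ ((n + 1) ^ 2 + 2 * j * (n + 1)) =
      q ^ (2 * j + 1) * q ^ (n ^ 2 + 2 * (j + 1) * n) := by ring
  rw [e, e1, e2, show n + 1 + i = n + (i + 1) by ring]
  field_simp

theorem tendsto_sparseSeries {q : ℂ} (hq : ‖q‖ < 1) {j i : ℕ → ℕ}
    (hj : Tendsto j atTop atTop) (hi : Tendsto i atTop atTop) :
    Tendsto (fun k => sparseSeries q (j k) (i k)) atTop (𝓝 1) := by
  have hq2 : ‖q ^ 2‖ < 1 := norm_pow_lt_one hq two_ne_zero
  obtain ⟨C, hC⟩ := exists_norm_sparseTerm_le hq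
  have hQ : ∀ n, Tendsto (fun k => negPochhammerInf (q ^ 2) (n + i k)) atTop (𝓝 1) := fun n =>
    (tendsto_negPochhammerInf hq2).comp (tendsto_atTop_mono (fun _ => Nat.le_add_left _ _) hi)
  have h := tendsto_tsum_of_dominated_convergence (𝓕 := atTop)
    (f := fun k n => sparseTerm q (j k) (i k) n) (g := fun n => if n = 0 then (1 : ℂ) else 0)
    ((summable_geometric_of_lt_one (norm_nonneg q) hq).mul_right C) (fun n => ?_)
    (Eventually.of_forall fun k n => hC (j k) (i k) n)
  · simpa [sparseSeries] using h
  · by_cases hn : n = 0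
    · subst hn
      simpa [sparseTerm, qPochhammer] using hQ 0
    · have h1 : Tendsto (fun k => q ^ (n ^ 2 + 2 * j k * n)) atTop (𝓝 0) := by
        refine (tendsto_pow_atTop_nhds_zero_of_norm_lt_one hq).comp
          (tendsto_atTop_mono (fun k => ?_) hj)
        have := Nat.pos_of_ne_zero hn
        nlinarith
      simpa [sparseTerm, hn] using (h1.mul_const (qPochhammer (q ^ 2) (q ^ 2) n)⁻¹).mul (hQ n)

theorem tsum_pow_sparseWeight {q : ℂ} (hq : ‖q‖ < 1) :
    ∑' T, q ^ sparseWeight 2 T = sparseSeries q 1 1 := by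
  -- `i` and `j` increase alternately, so the two shift relations take turns in giving the one
  -- recurrence.
  let h : ℕ → ℂ := fun k => sparseSeries q (k / 2 + 1) ((k + 1) / 2 + 1)
  have hrec : ∀ k, h k = h (k + 1) + q ^ (k + 2) * h (k + 2) := by
    intro k
    have hval : ∀ k j i, k / 2 + 1 = j → (k + 1) / 2 + 1 = i → h k = sparseSeries q j i := by
      rintro k _ _ rfl rfl
      rfl
    obtain ⟨m, rfl | rfl⟩ := k.even_or_odd'
    · rw [hval (2 * m) (m + 1) (m + 1) (by omega) (by omega),
        hval (2 * m + 1) (m + 1) (m + 2) (by omega) (by omega),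
        hval (2 * m + 2) (m + 2) (m + 2) (by omega) (by omega)]
      exact sparseSeries_shift_product hq (m + 1) (m + 1)
    · rw [hval (2 * m + 1) (m + 1) (m + 2) (by omega) (by omega),
        hval (2 * m + 1 + 1) (m + 2) (m + 2) (by omega) (by omega),
        hval (2 * m + 1 + 2) (m + 2) (m + 3) (by omega) (by omega)]
      exact sparseSeries_shift_exponent hq (m + 1) (m + 2)
  have hlim : Tendsto h atTop (𝓝 1) := by
    refine tendsto_sparseSeries hq ?_ ?_ <;>
      exact tendsto_atTop_mono (fun k => (by omega : k / 2 ≤ _))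
        (Nat.tendsto_div_const_atTop two_ne_zero)
  have := eq_zero_of_recurrence hq (d := fun k => ∑' T, q ^ sparseWeight (k + 2) T - h k)
    (fun k => by
      rw [tsum_pow_sparseWeight_succ hq k, hrec k]
      ring)
    (by simpa using (tendsto_tsum_pow_sparseWeight hq).sub hlim) 0
  exact sub_eq_zero.1 this

/-- Uses (q⁴;q⁴)_n = (q²;q²)_n (-q²;q²)_n; the second factor completes the tail of (-q²;q²)_∞. -/
theorem sparseTerm_one_one {q : ℂ} (hq : ‖q‖ < 1) (n : ℕ) :
    sparseTerm q 1 1 n = q ^ (n ^ 2 + 2 * n) / qPochhammer (q ^ 4) (q ^ 4) n *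
      qPochhammerInf (-q ^ 2) (q ^ 2) := by
  have hq2 : ‖q ^ 2‖ < 1 := norm_pow_lt_one hq two_ne_zero
  have hq4 : ‖q ^ 4‖ < 1 := norm_pow_lt_one hq four_ne_zero
  have h1 : qPochhammer (q ^ 4) (q ^ 4) n =
      qPochhammer (q ^ 2) (q ^ 2) n * qPochhammer (-(q ^ 2) ^ 1) (q ^ 2) n := by
    simp only [qPochhammer]
    rw [← Finset.prod_mul_distrib]
    exact Finset.prod_congr rfl fun k _ => by ring
  have h2 := qPochhammer_mul_negPochhammerInf hq2 1 n
  have h3 := qPochhammer_self_ne_zero hq4 n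
  rw [h1] at h3 ⊢
  have h4 := left_ne_zero_of_mul h3
  have h5 := right_ne_zero_of_mul h3
  have h6 : negPochhammerInf (q ^ 2) 1 = qPochhammerInf (-q ^ 2) (q ^ 2) := by
    rw [negPochhammerInf, pow_one]
  rw [← h6, ← h2, sparseTerm, mul_one]
  generalize qPochhammer (-(q ^ 2) ^ 1) (q ^ 2) n = x at h5 ⊢
  field_simp

theorem summable_pow_div_qPochhammer {q : ℂ} (hq : ‖q‖ < 1) :
    Summable fun n : ℕ => q ^ (n ^ 2 + 2 * n) / qPochhammer (q ^ 4) (q ^ 4) n := by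
  obtain ⟨C, hC⟩ := exists_norm_inv_qPochhammer_self_le (norm_pow_lt_one hq four_ne_zero)
  refine .of_norm_bounded ((summable_geometric_of_lt_one (norm_nonneg q) hq).mul_right C)
    fun n => ?_
  rw [div_eq_mul_inv, norm_mul, norm_pow]
  have h1 : ‖q‖ ^ (n ^ 2 + 2 * n) ≤ ‖q‖ ^ n :=
    pow_le_pow_of_le_one (norm_nonneg q) hq.le (by nlinarith)
  have h2 := hC n
  gcongr

theorem sparseSeries_one_one {q : ℂ} (hq : ‖q‖ < 1) :
    sparseSeries q 1 1 = (∑' n : ℕ, q ^ (n ^ 2 + 2 * n) / qPochhammer (q ^ 4) (q ^ 4) n) *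
      qPochhammerInf (-q ^ 2) (q ^ 2) := by
  rw [sparseSeries, ← tsum_mul_right]
  exact tsum_congr (sparseTerm_one_one hq)

/-! ### Partitions as suffix sums of their drops. -/

/-- Downward induction from beyond both supports. -/
theorem finsupp_eq_of_succ {s t : ℕ →₀ ℕ} (h : ∀ i, s (i + 1) = t (i + 1) → s i = t i) :
    s = t := by
  obtain ⟨n, hn⟩ := (s.support ∪ t.support).exists_nat_subset_range
  have hz : ∀ i, n ≤ i → s i = t i := fun i hi => by
    have hi' : i ∉ s.support ∪ t.support := fun h => by
      have := Finset.mem_range.1 (hn h)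
      omega
    simp only [Finset.mem_union, Finsupp.mem_support_iff, not_or, not_not] at hi'
    rw [hi'.1, hi'.2]
  have hk : ∀ k i, n ≤ i + k → s i = t i := by
    intro k
    induction k with
    | zero => exact hz
    | succ k ih => exact fun i hi => h i (ih (i + 1) (by omega))
  ext i
  exact hk n i (Nat.le_add_left n i)

/-- The sequence of suffix sums `i ↦ ∑ j ≥ i, N j`. -/
noncomputable def suffixSum : (ℕ →₀ ℕ) →ₗ[ℕ] (ℕ →₀ ℕ) :=
  Finsupp.linearCombination ℕ fun j => Finsupp.indicator (Finset.range (j + 1)) fun _ _ => 1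

theorem suffixSum_apply (N : ℕ →₀ ℕ) (i : ℕ) :
    suffixSum N i = N i + suffixSum N (i + 1) := by
  induction N using Finsupp.induction_linear with
  | zero => simp
  | add f g hf hg =>
    simp only [map_add, Finsupp.add_apply, hf, hg]
    ring
  | single j n =>
    simp only [suffixSum, Finsupp.linearCombination_single, Finsupp.smul_apply,
      Finsupp.indicator_apply, Finset.mem_range, Finsupp.single_apply]
    rcases lt_trichotomy i j with h | h | h
    · simp [h.ne', show i < j + 1 by omega, show i + 1 < j + 1 by omega]
    · simp [h]
    · simp [h.ne, show ¬ i < j + 1 by omega, show ¬ i + 1 < j + 1 by omega]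

theorem suffixSum_injective : Function.Injective suffixSum := by
  intro N M h
  ext i
  have h1 := suffixSum_apply N i
  rw [h, suffixSum_apply M i] at h1
  omega

theorem exists_suffixSum_eq {s : ℕ →₀ ℕ} (hs : ∀ i, s (i + 1) ≤ s i) :
    ∃ N : ℕ →₀ ℕ, suffixSum N = s ∧ ∀ i, N i = s i - s (i + 1) := by
  let N : ℕ →₀ ℕ := Finsupp.onFinset s.support (fun i => s i - s (i + 1)) fun i hi => by
    rw [Finsupp.mem_support_iff]
    omega
  refine ⟨N, finsupp_eq_of_succ fun i hi => ?_, fun i => rfl⟩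
  have h1 : N i = s i - s (i + 1) := rfl
  have := hs i
  rw [suffixSum_apply, hi, h1]
  omega

/-- A drop at position j is a column of height j + 1 in the Young diagram. -/
theorem degree_suffixSum (N : ℕ →₀ ℕ) : (suffixSum N).degree = multWeight 1 N := by
  induction N using Finsupp.induction_linear with
  | zero => simp
  | add f g hf hg => simp only [map_add, hf, hg]
  | single j n =>
    have h : (Finsupp.indicator (Finset.range (j + 1)) fun _ _ => 1 : ℕ →₀ ℕ).support =
        Finset.range (j + 1) := by
      ext i
      simp [Finsupp.indicator_apply]
    simp only [suffixSum, multWeight, Finsupp.linearCombination_single, map_nsmul, smul_eq_mul]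
    rw [Finsupp.degree_apply, h, Finset.sum_congr rfl fun i hi =>
      Finsupp.indicator_of_mem hi fun _ _ => 1]
    simp

/-! ### Sorting nearly antitone sequences. -/

/-- The map exchanging `t + 1` and `t + 2` for all `t ∈ T`. -/
def sparseSwapFun (T : SparseFinset) : ℕ → ℕ
  | 0 => 0
  | 1 => if 0 ∈ T.1 then 2 else 1
  | i + 2 => if i + 1 ∈ T.1 then i + 3 else if i ∈ T.1 then i + 1 else i + 2

theorem sparseSwapFun_involutive (T : SparseFinset) : Function.Involutive (sparseSwapFun T) := by
  have hT := T.2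
  intro i
  match i with
  | 0 => rfl
  | 1 => by_cases h : 0 ∈ T.1 <;> simp [sparseSwapFun, h, hT]
  | 2 => by_cases h : 0 ∈ T.1 <;> by_cases h' : 1 ∈ T.1 <;> simp_all [sparseSwapFun]
  | i + 3 =>
    by_cases h : i + 1 ∈ T.1
    · simp [sparseSwapFun, h, hT (i + 1) h]
    · by_cases h' : i + 2 ∈ T.1 <;> simp [sparseSwapFun, h, h', hT]

/-- The permutation exchanging `t + 1` and `t + 2` for all `t ∈ T`. -/
def sparseSwap (T : SparseFinset) : Equiv.Perm ℕ :=
  (sparseSwapFun_involutive T).toPerm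

/-- Sequences that are weakly decreasing up to exchanging adjacent entries, the first of
which is the largest one. -/
def IsNearlyAntitone (y : ℕ →₀ ℕ) : Prop :=
  y 1 ≤ y 0 ∧ ∀ i, y (i + 2) ≤ y i ∧ y (i + 3) ≤ y i

/-- The sequence with multiplicities `f` and ascents `T`. -/
noncomputable def nearlyAntitoneSeq (p : (ℕ →₀ ℕ) × SparseFinset) : ℕ →₀ ℕ :=
  Finsupp.equivMapDomain (sparseSwap p.2) (suffixSum (p.1 + sparseMult p.2))

theorem nearlyAntitoneSeq_apply (p : (ℕ →₀ ℕ) × SparseFinset) (i : ℕ) :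
    nearlyAntitoneSeq p i = suffixSum (p.1 + sparseMult p.2) (sparseSwapFun p.2 i) := rfl

theorem suffixSum_add_sparseMult_zero (p : (ℕ →₀ ℕ) × SparseFinset) :
    suffixSum (p.1 + sparseMult p.2) 1 ≤ suffixSum (p.1 + sparseMult p.2) 0 := by
  rw [suffixSum_apply _ 0]
  exact Nat.le_add_left _ _

theorem suffixSum_add_sparseMult_succ (p : (ℕ →₀ ℕ) × SparseFinset) (i : ℕ) :
    (if i ∈ p.2.1 then 1 else 0) + suffixSum (p.1 + sparseMult p.2) (i + 2) ≤
      suffixSum (p.1 + sparseMult p.2) (i + 1) := by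
  rw [suffixSum_apply _ (i + 1), Finsupp.add_apply, sparseMult_succ, add_assoc]
  exact Nat.le_add_left _ _

theorem isNearlyAntitone_nearlyAntitoneSeq (p : (ℕ →₀ ℕ) × SparseFinset) :
    IsNearlyAntitone (nearlyAntitoneSeq p) := by
  have hT := p.2.2
  have h0 := suffixSum_add_sparseMult_zero p
  have h1 := suffixSum_add_sparseMult_succ p
  simp only [IsNearlyAntitone, nearlyAntitoneSeq_apply]
  generalize suffixSum (p.1 + sparseMult p.2) = s at *
  have h1' : ∀ i, s (i + 2) ≤ s (i + 1) := fun i => (Nat.le_add_left _ _).trans (h1 i)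
  refine ⟨?_, fun i => ?_⟩
  · simp only [sparseSwapFun]
    grind
  · match i with
    | 0 => simp only [sparseSwapFun]; grind
    | 1 => simp only [sparseSwapFun]; grind
    | i + 2 =>
      simp only [sparseSwapFun]
      have := h1' i
      have := h1' (i + 1)
      have := h1' (i + 2)
      have := h1' (i + 3)
      have := h1' (i + 4)
      have := hT i
      have := hT (i + 1)
      grind

/-- The summand `sparseMult` forces a strict drop at each exchanged pair, so the exchange is visible
as an ascent and `T` can be recovered. -/
theorem mem_iff_nearlyAntitoneSeq_lt (p : (ℕ →₀ ℕ) × SparseFinset) (t : ℕ) :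
    t ∈ p.2.1 ↔ nearlyAntitoneSeq p (t + 1) < nearlyAntitoneSeq p (t + 2) := by
  have hT := p.2.2
  have h0 := suffixSum_add_sparseMult_zero p
  have h1 := suffixSum_add_sparseMult_succ p
  simp only [nearlyAntitoneSeq_apply]
  generalize suffixSum (p.1 + sparseMult p.2) = s at *
  match t with
  | 0 =>
    have := h1 0
    have := h1 1
    have := hT 0
    simp only [sparseSwapFun]
    grind
  | t + 1 =>
    have := h1 t
    have := h1 (t + 1)
    have := h1 (t + 2)
    have := hT t
    have := hT (t + 1)
    simp only [sparseSwapFun]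
    grind

theorem nearlyAntitoneSeq_injective : Function.Injective nearlyAntitoneSeq := by
  rintro ⟨f, T⟩ ⟨g, U⟩ h
  obtain rfl : T = U := by
    ext t
    rw [mem_iff_nearlyAntitoneSeq_lt (f, T), h, ← mem_iff_nearlyAntitoneSeq_lt (g, U)]
  have h1 := suffixSum_injective ((Finsupp.equivCongrLeft (sparseSwap T)).injective h)
  exact Prod.ext (add_right_cancel h1) rfl

theorem exists_nearlyAntitoneSeq_eq {y : ℕ →₀ ℕ} (hy : IsNearlyAntitone y) :
    ∃ p, nearlyAntitoneSeq p = y := by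
  obtain ⟨hy0, hy⟩ := hy
  -- The ascents of `y`. Two consecutive ones would contradict the inequality at distance two.
  let T : SparseFinset :=
    ⟨(y.support.preimage (· + 2) (add_left_injective 2).injOn).filter
      fun t => y (t + 1) < y (t + 2), fun t ht ht' => by
        have h1 := (Finset.mem_filter.1 ht).2
        have h2 := (Finset.mem_filter.1 ht').2
        exact absurd (h1.trans h2) (hy (t + 1)).1.not_gt⟩
  have hT : ∀ t, t ∈ T.1 ↔ y (t + 1) < y (t + 2) := fun t => by
    simp only [T, Finset.mem_filter, Finset.mem_preimage, Finsupp.mem_support_iff]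
    omega
  let s : ℕ →₀ ℕ := Finsupp.equivMapDomain (sparseSwap T) y
  have hsv : ∀ i, s i = y (sparseSwapFun T i) := fun i => rfl
  -- The sorted sequence decreases, strictly where an ascent was reversed; hence its drops dominate
  -- `sparseMult T`.
  have hs : ∀ i, s (i + 1) + sparseMult T i ≤ s i := by
    intro i
    match i with
    | 0 =>
      rw [hsv, hsv, sparseMult_zero]
      simp only [sparseSwapFun, hT]
      have := hy 0
      grind
    | 1 =>
      rw [hsv, hsv, sparseMult_succ]
      simp only [sparseSwapFun, hT]
      have := hy 0
      have := hy 1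
      grind
    | i + 2 =>
      rw [hsv, hsv, sparseMult_succ]
      simp only [sparseSwapFun, hT]
      have := hy i
      have := hy (i + 1)
      have := hy (i + 2)
      grind
  obtain ⟨N, hN, hN'⟩ := exists_suffixSum_eq fun i => (Nat.le_add_right _ _).trans (hs i)
  have hle : sparseMult T ≤ N := fun i => by
    have := hs i
    rw [hN']
    omega
  refine ⟨(N - sparseMult T, T), ?_⟩
  ext i
  rw [nearlyAntitoneSeq_apply, tsub_add_cancel_of_le hle, hN, hsv, sparseSwapFun_involutive T]

theorem degree_equivMapDomain {α β : Type*} (e : α ≃ β) (f : α →₀ ℕ) :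
    (Finsupp.equivMapDomain e f).degree = f.degree :=
  Finsupp.sum_equivMapDomain e f fun _ n => n

theorem degree_nearlyAntitoneSeq (p : (ℕ →₀ ℕ) × SparseFinset) :
    (nearlyAntitoneSeq p).degree = multWeight 1 p.1 + sparseWeight 2 p.2 := by
  rw [nearlyAntitoneSeq, degree_equivMapDomain, degree_suffixSum, map_add, multWeight_sparseMult]

/-- Nearly antitone sequences correspond to pairs of a multiplicity function and a sparse set. -/
noncomputable def nearlyAntitoneEquiv :
    (ℕ →₀ ℕ) × SparseFinset ≃ {y : ℕ →₀ ℕ // IsNearlyAntitone y} :=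
  Equiv.ofBijective (fun p => ⟨nearlyAntitoneSeq p, isNearlyAntitone_nearlyAntitoneSeq p⟩)
    ⟨fun _ _ h => nearlyAntitoneSeq_injective (congrArg Subtype.val h), fun y =>
      (exists_nearlyAntitoneSeq_eq y.2).imp fun _ h => Subtype.ext h⟩

/-! ### Interleaving the two rows. -/

/-- The interleaving `λ₀, λ₁, μ₀, λ₂, μ₁, λ₃, μ₂, …` of two sequences. -/
def interleave : ℕ ⊕ ℕ ≃ ℕ where
  -- Truncated subtraction sends λ₀ to position 0.
  toFun := Sum.elim (fun j => 2 * j - 1) fun j => 2 * j + 2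
  invFun n := if n = 0 then .inl 0 else if n % 2 = 1 then .inl ((n + 1) / 2) else .inr (n / 2 - 1)
  left_inv := by
    rintro (j | j)
    · rcases j with - | j
      · rfl
      · have h : 2 * (j + 1) - 1 = 2 * j + 1 := by omega
        simp only [Sum.elim_inl, h]
        rw [if_neg (by omega), if_pos (by omega)]
        congr 1
        omega
    · change (if 2 * j + 2 = 0 then Sum.inl 0 else if (2 * j + 2) % 2 = 1 then
        Sum.inl ((2 * j + 2 + 1) / 2) else Sum.inr ((2 * j + 2) / 2 - 1)) = _
      rw [if_neg (by omega), if_neg (by omega)]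
      congr 1
      omega
  right_inv n := by
    dsimp only
    split_ifs <;> simp only [Sum.elim_inl, Sum.elim_inr] <;> omega

theorem interleave_symm_odd (j : ℕ) : interleave.symm (2 * j + 1) = .inl (j + 1) := by
  rw [Equiv.symm_apply_eq]
  simp only [interleave, Equiv.coe_fn_mk, Sum.elim_inl]
  omega

theorem interleave_symm_even (j : ℕ) : interleave.symm (2 * j + 2) = .inr j := by
  rw [Equiv.symm_apply_eq]
  rfl

/-- The interleaving of two finitely supported sequences. -/
noncomputable def interleaveSeq : (ℕ →₀ ℕ) × (ℕ →₀ ℕ) ≃ (ℕ →₀ ℕ) :=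
  Finsupp.sumFinsuppEquivProdFinsupp.symm.trans (Finsupp.equivCongrLeft interleave)

theorem interleaveSeq_apply (a b : ℕ →₀ ℕ) :
    interleaveSeq (a, b) = Finsupp.equivMapDomain interleave (a.sumElim b) := rfl

/-- Away from position 0, distance two compares entries of the same row, and distance three gives λ
≥ μ from odd positions and the shifted inequality μ ≥ λ from even ones. -/
theorem isNearlyAntitone_interleaveSeq_iff (a b : ℕ →₀ ℕ) :
    IsNearlyAntitone (interleaveSeq (a, b)) ↔
      Antitone a ∧ Antitone b ∧ (∀ j, b j ≤ a j) ∧ ∀ j, a (j + 3) ≤ b j := by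
  set y := interleaveSeq (a, b) with hy
  have y0 : y 0 = a 0 := rfl
  have yo : ∀ j, y (2 * j + 1) = a (j + 1) := fun j => by
    rw [hy, interleaveSeq_apply, Finsupp.equivMapDomain_apply, interleave_symm_odd]
    rfl
  have ye : ∀ j, y (2 * j + 2) = b j := fun j => by
    rw [hy, interleaveSeq_apply, Finsupp.equivMapDomain_apply, interleave_symm_even]
    rfl
  constructor
  · rintro ⟨h0, h⟩
    refine ⟨antitone_nat_of_succ_le fun j => ?_, antitone_nat_of_succ_le fun j => ?_,
      fun j => ?_, fun j => ?_⟩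
    · cases j with
      | zero => rw [← yo, ← y0]; exact h0
      | succ j => rw [← yo, ← yo]; exact (h _).1
    · rw [← ye, ← ye]; exact (h _).1
    · cases j with
      | zero => rw [← ye, ← y0]; exact (h 0).1
      | succ j => rw [← ye, ← yo]; exact (h _).2
    · rw [← ye, ← yo]; exact (h _).2
  · rintro ⟨ha, hb, hba, hab⟩
    refine ⟨?_, fun i => ?_⟩
    · rw [y0, yo 0]; exact ha (Nat.zero_le _)
    -- λ₀ stands outside the alternating pattern: its comparisons are with μ₀ and λ₂.
    · obtain rfl | i := i
      · refine ⟨?_, ?_⟩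
        · rw [y0, ye 0]; exact hba 0
        · rw [y0, yo 1]; exact ha (Nat.zero_le _)
      · obtain ⟨j, rfl | rfl⟩ := i.even_or_odd'
        · rw [yo, show 2 * j + 1 + 2 = 2 * (j + 1) + 1 by ring, yo,
            show 2 * j + 1 + 3 = 2 * (j + 1) + 2 by ring, ye]
          exact ⟨ha (by omega), hba _⟩
        · rw [show 2 * j + 1 + 1 = 2 * j + 2 by ring, ye,
            show 2 * j + 2 + 2 = 2 * (j + 1) + 2 by ring, ye,
            show 2 * j + 2 + 3 = 2 * (j + 2) + 1 by ring, yo]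
          exact ⟨hb (by omega), hab _⟩

/-- Cylindric partitions with profile `(3, 0)` as pairs of rows. -/
noncomputable def cylindricPartitionEquiv :
    CylindricPartition (![3, 0] : Fin 2 → ℕ) ≃ {y : ℕ →₀ ℕ // IsNearlyAntitone y} where
  toFun Λ := ⟨interleaveSeq (Λ.row 0, Λ.row 1), (isNearlyAntitone_interleaveSeq_iff _ _).2
    -- `Λ.row_le 1` wraps around, as 1 + 1 = 0 in `Fin 2`, and carries the shift by 3.
    ⟨Λ.row_antitone 0, Λ.row_antitone 1, Λ.row_le 0, Λ.row_le 1⟩⟩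
  invFun y :=
    have h := (isNearlyAntitone_interleaveSeq_iff (interleaveSeq.symm y.1).1
      (interleaveSeq.symm y.1).2).1 (by
        rw [Prod.mk.eta, Equiv.apply_symm_apply]
        exact y.2)
    { row := ![(interleaveSeq.symm y.1).1, (interleaveSeq.symm y.1).2]
      row_antitone := Fin.forall_fin_two.2 ⟨h.1, h.2.1⟩
      row_le := Fin.forall_fin_two.2 ⟨h.2.2.1, h.2.2.2⟩ }
  left_inv Λ := by
    obtain ⟨row, _, _⟩ := Λ
    simp only [Equiv.symm_apply_apply, CylindricPartition.mk.injEq]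
    funext i
    fin_cases i <;> rfl
  right_inv y := Subtype.ext (interleaveSeq.apply_symm_apply y.1)

theorem degree_cylindricPartitionEquiv (Λ : CylindricPartition (![3, 0] : Fin 2 → ℕ)) :
    (cylindricPartitionEquiv Λ).1.degree = Λ.size := by
  simp only [cylindricPartitionEquiv, Equiv.coe_fn_mk]
  rw [interleaveSeq_apply, degree_equivMapDomain, CylindricPartition.size, Fin.sum_univ_two]
  exact Finsupp.sum_sumElim _ _ fun _ n => n

/-! ### Assembling the generating function. -/

theorem mainTheorem5 (q : ℂ) (hq : ‖q‖ < 1) :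
    Summable (fun n : ℕ => q ^ (n ^ 2 + 2 * n) / qPochhammer (q ^ 4) (q ^ 4) n) ∧
    HasSum (fun Λ : CylindricPartition (![3, 0] : Fin 2 → ℕ) => q ^ Λ.size)
      ((∑' n : ℕ, q ^ (n ^ 2 + 2 * n) / qPochhammer (q ^ 4) (q ^ 4) n) *
        (qPochhammerInf (-q ^ 2) (q ^ 2) / qPochhammerInf q q)) := by
  refine ⟨summable_pow_div_qPochhammer hq, ?_⟩
  have h1 := summable_norm_pow_multWeight hq 0
  have h2 := summable_norm_pow_sparseWeight hq 0
  have h := (summable_mul_of_summable_norm h1 h2).hasSum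
  rw [← tsum_mul_tsum_of_summable_norm h1 h2, zero_add, zero_add, tsum_pow_multWeight hq,
    tsum_pow_sparseWeight hq, sparseSeries_one_one hq] at h
  rw [← (nearlyAntitoneEquiv.trans cylindricPartitionEquiv.symm).hasSum_iff, div_eq_mul_inv,
    ← mul_assoc, mul_comm]
  refine h.congr_fun fun p => ?_
  rw [← pow_add, ← degree_nearlyAntitoneSeq, Function.comp_apply,
    ← degree_cylindricPartitionEquiv, Equiv.trans_apply, Equiv.apply_symm_apply]
  rfl
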